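/- Let $(p_k)_{k\ge 0}$ be an offspring distribution with $p_0=0$, $p_k<1$ for all $k$, and finite mean $m=\sum_k k\,p_k$ (so that $1<m<\infty$), and let $\mathbf{GW}$ be the law of the Galton–Watson tree with this offspring distribution. For $\lambda>0$, the $\lambda$-biased random walk on a rooted tree moves, from the root, to a uniformly chosen child and, from any other vertex $x$ with $\nu(x)$ children, to the parent of $x$ with probability $\lambda/(\nu(x)+\lambda)$ and to each child with probability $1/(\nu(x)+\lambda)$. For a rooted tree $T$ with root $e$, let $T_*$ be the tree obtained by attaching a parent $e_*$ to $e$ and rooting at $e_*$; let $\beta_\lambda(T)$ be the probability that the $\lambda$-biased walk on $T_*$ started from $e$ never visits $e_*$; and let $\mathcal C_\lambda(T)$ be the effective conductance from the root of $T$ to infinity when the edges between levels $n$ and $n+1$ have conductance $\lambda^{-n}$, that is, the number of children of the root times the probability that the $\lambda$-biased walk on $T$ started from the root never returns to it. Let $\mathbb T,\mathbb T^+$ be independent with law $\mathbf{GW}$, and let $\nu^+$ be the number of children of the root of $\mathbb T^+$. Given $(\mathbb T,\mathbb T^+)$, let $\mathcal R$ be the $\lambda$-harmonic ray of $\mathbb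 T$, i.e. the loop erasure of the $\lambda$-biased walk on $\mathbb T$ started from the root. Let $\mathbb T \multimap \mathbb T^+$ be the tree obtained by joining the two roots by an edge, rooted at the root of $\mathbb T^+$ and marked by the ray $\mathcal R$ (prolonged to the new root). For $0<\lambda<m$, the $\lambda$-augmented Galton–Watson measure $\mathbf{AGW}_\lambda$ is the probability measure on trees with a marked ray which has density $$c_\lambda^{-1}\,\frac{(\lambda+\nu^+)\,\beta_\lambda(\mathbb T)}{\lambda-1+\beta_\lambda(\mathbb T)+\mathcal C_\lambda(\mathbb T^+)}$$ with respect to the law of $(\mathbb T \multimap \mathbb T^+,\mathcal R)$, where $c_\lambda$ is the normalizing constant. For a rooted tree, let $\nu^+(e)$ denote the number of children of the root minus one. Then, for every $0<\lambda<1$, $\mathbf{AGW}_\lambda$ is indeed a probability measure under which $\nu^+(e)$ is integrable, and $$\lim_{\lambda\to 0^+}\int \nu^+(e)\,\mathbf{AGW}_\lambda(\mathrm dT,\mathrm d\xi)=m .$$ -/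

import Mathlib

open MeasureTheory ProbabilityTheory Filter Topology
open scoped NNReal ENNReal

namespace BiasedWalk

/-! ### Trees

Vertices are words over `ℕ` (Ulam–Harris labelling): the root is the empty word `[]`, and the
children of `x` are `x ++ [0], …, x ++ [k - 1]`, where `k` is the number of children of `x`. -/

/-- Words form a countable discrete space. -/
instance instMeasurableSpaceWord : MeasurableSpace (List ℕ) := ⊤

instance instDiscreteMeasurableSpaceWord : DiscreteMeasurableSpace (List ℕ) :=
  ⟨fun _ => trivial⟩

/-- The space of infinite, locally finite, rooted (plane) trees without leaves.  A tree is given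
by its child-count function `T : List ℕ → ℕ`: the vertices are the words `x` with `0 < T x`, and
`T x` is then the number of children of `x`; words that are not vertices have the value `0`.
The σ-algebra is generated by the coordinates. -/
abbrev LeaflessTree : Type :=
  {T : List ℕ → ℕ // 0 < T [] ∧ ∀ x i, 0 < T (x ++ [i]) ↔ i < T x}

/-- `T.children x` is the number of children of the vertex `x` of `T`. -/
def LeaflessTree.children (T : LeaflessTree) (x : List ℕ) : ℕ := T.1 x

/-- Child counts of the tree in which a word `x` that is a vertex has `max 1 (g x)` children. -/
def treeFun : (List ℕ → ℕ) → List ℕ → ℕ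
  | g, [] => max 1 (g [])
  | g, i :: x => if i < max 1 (g []) then treeFun (fun y => g (i :: y)) x else 0

theorem treeFun_append (x : List ℕ) (i : ℕ) (g : List ℕ → ℕ) :
    0 < treeFun g (x ++ [i]) ↔ i < treeFun g x := by
  induction x generalizing g with
  | nil =>
    have h1 : 0 < max 1 (g [i]) := lt_of_lt_of_le one_pos (le_max_left _ _)
    by_cases h : i < max 1 (g [])
    · simp only [List.nil_append, treeFun, h, if_true, h1]
    · simp only [List.nil_append, treeFun, h, if_false, lt_irrefl]
  | cons j x ih =>
    by_cases h : j < max 1 (g [])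
    · simp only [List.cons_append, treeFun, if_pos h]
      exact ih _
    · simp only [List.cons_append, treeFun, if_neg h]
      simp

/-- The tree built from labels: the vertex `x` receives `g x` children.  (A label `0` is read as
`1`, so that the result is always leafless; under an offspring law with `p 0 = 0` all the labels
are almost surely positive and this convention plays no role.) -/
def treeOfLabels (g : List ℕ → ℕ) : LeaflessTree :=
  ⟨treeFun g, by simp [treeFun], fun x i => treeFun_append x i g⟩

/-- The Galton–Watson measure with offspring law `p` (where `p 0 = 0`): the law of the tree whose
vertices have i.i.d. numbers of children with law `p`. -/
noncomputable def gw (p : PMF ℕ) : Measure LeaflessTree :=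
  (Measure.infinitePi fun _ : List ℕ => p.toMeasure).map treeOfLabels

/-- Child counts of `T_*`. -/
def addParentFun (T : List ℕ → ℕ) : List ℕ → ℕ
  | [] => 1
  | 0 :: x => T x
  | (_ + 1) :: _ => 0

/-- The tree `T_*`, obtained from `T` by giving the root `e` of `T` a parent `e_*`, which is the
root of `T_*`.  So `e_* = []`, and the vertex `x` of `T` becomes `0 :: x`. -/
def addParent (T : LeaflessTree) : LeaflessTree :=
  ⟨addParentFun T.1, by simp [addParentFun], by
    rintro (_ | ⟨_ | j, x⟩) i
    · rcases i with _ | i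
      · simpa [addParentFun] using T.2.1
      · simp [addParentFun]
    · simpa [addParentFun] using T.2.2 x i
    · simp [addParentFun]⟩

/-- Child counts of the tree obtained by joining the roots of two trees. -/
def joinFun (T T' : List ℕ → ℕ) : List ℕ → ℕ
  | [] => T' [] + 1
  | 0 :: x => T x
  | (i + 1) :: x => T' (i :: x)

/-- The tree obtained by joining the roots of `T` and `T'` by an edge, rooted at the root `e'`
of `T'`.  The root `e = [0]` of `T` is listed as the first child of `e'`, and the former `i`-th
child of `e'` becomes its `(i + 1)`-st child. -/
def join (T T' : LeaflessTree) : LeaflessTree :=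
  ⟨joinFun T.1 T'.1, by simp [joinFun], by
    rintro (_ | ⟨_ | j, x⟩) i
    · rcases i with _ | i
      · simpa [joinFun] using T.2.1
      · simpa [joinFun] using T'.2.2 [] i
    · simpa [joinFun] using T.2.2 x i
    · simpa [joinFun] using T'.2.2 (j :: x) i⟩

/-! ### The `lam`-biased random walk -/

/-- Law of the next position of the `lam`-biased walk at a vertex `x` that has `k` children:
from the root all children are equally likely; from another vertex the walk moves to the parent
with probability `lam / (k + lam)` and to each child with probability `1 / (k + lam)`.
(Words that are not vertices, `k = 0`, are never visited and are made absorbing.) -/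
noncomputable def stepMeasure (lam : ℝ≥0) (x : List ℕ) (k : ℕ) : Measure (List ℕ) :=
  if k = 0 then Measure.dirac x
  else if x = [] then ∑ i ∈ Finset.range k, (1 / (k : ℝ≥0)) • Measure.dirac [i]
  else (lam / (k + lam)) • Measure.dirac x.dropLast
    + ∑ i ∈ Finset.range k, (1 / (k + lam)) • Measure.dirac (x ++ [i])

theorem isProbabilityMeasure_stepMeasure (lam : ℝ≥0) (x : List ℕ) (k : ℕ) :
    IsProbabilityMeasure (stepMeasure lam x k) := by
  constructor
  unfold stepMeasure
  split_ifs with hk hx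
  · simp
  · have hk' : (k : ℝ≥0) ≠ 0 := by exact_mod_cast hk
    have h : (k : ℝ≥0) * (1 / k) = 1 := by field_simp
    have h2 := congrArg (fun r : ℝ≥0 => (r : ℝ≥0∞)) h
    simp only [Measure.coe_finsetSum, Finset.sum_apply, Measure.smul_apply, measure_univ,
      ENNReal.smul_def, smul_eq_mul, mul_one, Finset.sum_const, Finset.card_range, nsmul_eq_mul]
    exact_mod_cast h2
  · have hk' : (k : ℝ≥0) + lam ≠ 0 := by
      have : (k : ℝ≥0) ≠ 0 := by exact_mod_cast hk
      positivity
    have h : lam / (k + lam) + (k : ℝ≥0) * (1 / (k + lam)) = 1 := by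
      field_simp
      ring
    have h2 := congrArg (fun r : ℝ≥0 => (r : ℝ≥0∞)) h
    simp only [Measure.add_apply, Measure.coe_finsetSum, Finset.sum_apply, Measure.smul_apply,
      measure_univ, ENNReal.smul_def, smul_eq_mul, mul_one, Finset.sum_const, Finset.card_range,
      nsmul_eq_mul]
    exact_mod_cast h2

/-- Law of the next position, as a kernel in the tree and the present position. -/
noncomputable def posKernel (lam : ℝ≥0) : Kernel (LeaflessTree × List ℕ) (List ℕ) :=
  (Kernel.ofFunOfCountable fun q : List ℕ × ℕ => stepMeasure lam q.1 q.2).comap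
    (fun q : LeaflessTree × List ℕ => (q.2, q.1.children q.2)) (by
      have h : Measurable fun q : List ℕ × LeaflessTree => q.2.children q.1 :=
        measurable_from_prod_countable_right fun x =>
          (measurable_pi_apply x).comp measurable_subtype_coe
      exact measurable_snd.prodMk (h.comp measurable_swap))

instance instIsMarkovKernelPosKernel (lam : ℝ≥0) : IsMarkovKernel (posKernel lam) :=
  ⟨fun q => isProbabilityMeasure_stepMeasure lam q.2 (q.1.children q.2)⟩

/-- One step of the walk together with its tree, which does not change. -/
noncomputable def envKernel (lam : ℝ≥0) :
    Kernel (LeaflessTree × List ℕ) (LeaflessTree × List ℕ) :=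
  (Kernel.deterministic Prod.fst measurable_fst) ×ₖ posKernel lam

instance instIsMarkovKernelEnvKernel (lam : ℝ≥0) : IsMarkovKernel (envKernel lam) := by
  unfold envKernel
  infer_instance

/-- Law of the trajectory `(S_0, S_1, …)` of the Markov chain with transition kernel `K`, as a
kernel in the starting point `S_0`. -/
noncomputable def markovChain {S : Type} [MeasurableSpace S] (K : Kernel S S)
    [IsMarkovKernel K] : Kernel S (ℕ → S) :=
  (Kernel.traj (X := fun _ => S)
    (fun n => K.comap (fun h : (i : Finset.Iic n) → S => h ⟨n, by simp⟩)
      (measurable_pi_apply _)) 0).comap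
    (fun s _ => s) (measurable_pi_lambda _ fun _ => measurable_id)

/-- `walk lam (T, x)` is the law of the trajectory `(X_0, X_1, …)` of the `lam`-biased random walk
on the tree `T` started from the vertex `x`. -/
noncomputable def walk (lam : ℝ≥0) : Kernel (LeaflessTree × List ℕ) (ℕ → List ℕ) :=
  (markovChain (envKernel lam)).map fun w n => (w n).2

/-- The escape probability `β_lam(T)`: the probability that the `lam`-biased walk on `T_*`
started from the root `e = [0]` of `T` never visits the parent `e_* = []` of `e`. -/
noncomputable def escapeProb (lam : ℝ≥0) (T : LeaflessTree) : ℝ :=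
  (walk lam (addParent T, [0])).real {X | ∀ n, X n ≠ []}

/-- The conductance of an edge between a vertex of level `n` and one of level `n + 1`. -/
noncomputable def edgeConductance (lam : ℝ≥0) (n : ℕ) : ℝ := ((lam : ℝ) ^ n)⁻¹

/-- The effective conductance `C_lam(T)` of the network `T` from the root `e` to infinity: the
total conductance of the edges at `e` times the probability that the associated network walk
(which moves along an edge with probability proportional to its conductance, that is, the
`lam`-biased walk) started from `e` never returns to `e`. -/
noncomputable def effConductance (lam : ℝ≥0) (T : LeaflessTree) : ℝ :=
  (∑ _i ∈ Finset.range (T.children []), edgeConductance lam 0) *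
    (walk lam (T, [])).real {X | ∀ n, 1 ≤ n → X n ≠ []}

/-! ### Rays and the harmonic ray -/

/-- `ξ` is an infinite ray in `T` emanating from the root. -/
def IsRay (T : LeaflessTree) (ξ : ℕ → List ℕ) : Prop :=
  ξ 0 = [] ∧ ∀ n, ∃ i < T.children (ξ n), ξ (n + 1) = ξ n ++ [i]

/-- The last time at which the trajectory `X` visits `x`. -/
noncomputable def lastVisit (X : ℕ → List ℕ) (x : List ℕ) : ℕ := sSup {n | X n = x}

/-- The (chronological) loop erasure of a trajectory that visits every vertex finitely often. -/
noncomputable def loopErase (X : ℕ → List ℕ) : ℕ → List ℕ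
  | 0 => X 0
  | n + 1 => X (lastVisit X (loopErase X n) + 1)

/-- The leftmost ray of a tree. -/
def leftmostRay (n : ℕ) : List ℕ := List.replicate n 0

theorem isRay_leftmostRay (T : LeaflessTree) : IsRay T leftmostRay := by
  have hs : ∀ n, leftmostRay (n + 1) = leftmostRay n ++ [0] := fun n => by
    simp [leftmostRay, List.replicate_succ']
  refine ⟨rfl, fun n => ⟨0, ?_, hs n⟩⟩
  change 0 < T.1 (leftmostRay n)
  induction n with
  | zero => exact T.2.1
  | succ n ih =>
    rw [hs]
    exact (T.2.2 _ _).2 ih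

open Classical in
/-- The `lam`-harmonic ray: the loop erasure of the trajectory `X` of the walk on `T` started from
the root.  When the walk is transient this is almost surely a ray of `T`; on the exceptional null
set an arbitrary ray is used. -/
noncomputable def harmonicRay (T : LeaflessTree) (X : ℕ → List ℕ) : ℕ → List ℕ :=
  if IsRay T (loopErase X) then loopErase X else leftmostRay

theorem isRay_harmonicRay (T : LeaflessTree) (X : ℕ → List ℕ) : IsRay T (harmonicRay T X) := by
  unfold harmonicRay
  split_ifs with h
  · exact h
  · exact isRay_leftmostRay T

/-- The space of trees with a marked ray. -/
abbrev MarkedTree : Type := {q : LeaflessTree × (ℕ → List ℕ) // IsRay q.1 q.2}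

/-- A ray of `T`, prolonged to a ray of `join T T'` by putting the root of `T'` in front. -/
def prolong (ξ : ℕ → List ℕ) : ℕ → List ℕ
  | 0 => []
  | n + 1 => 0 :: ξ n

theorem isRay_prolong (T T' : LeaflessTree) {ξ : ℕ → List ℕ} (h : IsRay T ξ) :
    IsRay (join T T') (prolong ξ) := by
  refine ⟨rfl, ?_⟩
  rintro (_ | n)
  · exact ⟨0, Nat.succ_pos _, by simp [prolong, h.1]⟩
  · obtain ⟨i, hi, hi'⟩ := h.2 n
    exact ⟨i, hi, by simp [prolong, hi']⟩

/-! ### The augmented Galton–Watson measure -/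

/-- The joint law of `((T, T⁺), X)`: `T` and `T⁺` are independent Galton–Watson trees and, given
these, `X` is the `lam`-biased random walk on `T` started from the root. -/
noncomputable def baseLaw (p : PMF ℕ) (lam : ℝ≥0) :
    Measure ((LeaflessTree × LeaflessTree) × (ℕ → List ℕ)) :=
  ((gw p).prod (gw p)) ⊗ₘ
    ((walk lam).comap (fun q : LeaflessTree × LeaflessTree => (q.1, ([] : List ℕ)))
      (measurable_fst.prodMk measurable_const))

/-- The tree `join T T⁺`, rooted at the root of `T⁺`, marked by the harmonic ray of `T`. -/
noncomputable def markedJoin (w : (LeaflessTree × LeaflessTree) × (ℕ → List ℕ)) : MarkedTree :=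
  ⟨(join w.1.1 w.1.2, prolong (harmonicRay w.1.1 w.2)),
    isRay_prolong _ _ (isRay_harmonicRay _ _)⟩

/-- The unnormalised density `(lam + ν⁺) β(T) / (lam - 1 + β(T) + C(T⁺))`, where `ν⁺` is the
number of children of the root of `T⁺`. -/
noncomputable def agwWeight (lam : ℝ≥0) (T T' : LeaflessTree) : ℝ :=
  (lam + T'.children []) * escapeProb lam T /
    (lam - 1 + escapeProb lam T + effConductance lam T')

/-- The normalising constant `c_lam`, the expectation of the density above. -/
noncomputable def agwConst (p : PMF ℕ) (lam : ℝ≥0) : ℝ≥0∞ :=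
  ∫⁻ w, ENNReal.ofReal (agwWeight lam w.1.1 w.1.2) ∂baseLaw p lam

/-- The `lam`-augmented Galton–Watson measure: the law of the marked tree `(join T T⁺, R)` under
the probability measure with density `c_lam⁻¹ (lam + ν⁺) β(T) / (lam - 1 + β(T) + C(T⁺))`.
(`T` and `T⁺` are the two parts into which the marked tree falls when the first edge of its marked
ray is cut, so this is a density with respect to the law of `(join T T⁺, R)`.) -/
noncomputable def agw (p : PMF ℕ) (lam : ℝ≥0) : Measure MarkedTree :=
  ((baseLaw p lam).withDensity fun w =>
    (agwConst p lam)⁻¹ * ENNReal.ofReal (agwWeight lam w.1.1 w.1.2)).map markedJoin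

/-- `ν⁺(e)`: the number of children of the root, minus one. -/
def nuPlus (τ : MarkedTree) : ℝ := (τ.1.1.children [] : ℝ) - 1

end BiasedWalk

/-! On a leafless tree, for `lam ≤ 1`, the function `lam ^ |x|` is superharmonic away from the root
and equals 1 at the root. By the maximum principle (`markovChain_hit_le`), a walk started at level
1, or making its first step from the root, reaches the root afterwards with probability at most
`lam`. For `lam < 1` this gives, on every tree, `1 - lam ≤ β ≤ 1` and `(1 - lam) ν ≤ C ≤ ν`, where
`ν` is the number of children of the root.

These estimates trap the unnormalised density, and hence its mean `c_lam`, between `1 - lam` and `(1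
+ lam) / (1 - lam)` (`agwWeight_bounds`). So the augmented measure lies between `D⁻¹` and `D` times
the unweighted law of the marked join, with `D = (1 + lam) / (1 - lam)²` (`agw_le`, `le_agw`). Under
the unweighted law `ν⁺(e)` has mean `m` whatever `lam` is, and `D → 1` as `lam → 0`, so the limit
follows by squeezing. -/

namespace BiasedWalk

/-! ### Markov property and a hitting estimate for general chains. -/

section MarkovChain

variable {S : Type} [MeasurableSpace S] (K : Kernel S S) [IsMarkovKernel K]

instance instIsMarkovKernelMarkovChain : IsMarkovKernel (markovChain K) := by
  unfold markovChain
  infer_instance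

/-- Base case of the hitting estimate, which counts visits from time 1 on because the start may lie
in the target set. -/
theorem lintegral_markovChain_one (s : S) {h : S → ℝ≥0∞} (hh : Measurable h) :
    ∫⁻ x, h (x 1) ∂markovChain K s = ∫⁻ z, h z ∂K s := by
  rw [← lintegral_map hh (measurable_pi_apply 1), ← Kernel.map_apply _ (measurable_pi_apply 1)]
  congr 1
  rw [markovChain, Kernel.map_apply _ (measurable_pi_apply 1), Kernel.comap_apply,
    ← Kernel.map_apply _ (measurable_pi_apply 1)]
  have := Kernel.map_traj_succ_self (X := fun _ => S) (a := 0)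
    (κ := fun n => K.comap (fun h : (i : Finset.Iic n) → S => h ⟨n, by simp⟩)
      (measurable_pi_apply _))
  rw [zero_add] at this
  rw [this, Kernel.comap_apply]

/-- The simple Markov property at time `n`. -/
theorem lintegral_markovChain_succ (s : S) (n : ℕ)
    {f : ((Finset.Iic n → S) × S) → ℝ≥0∞} (hf : Measurable f) :
    ∫⁻ x, f (Preorder.frestrictLe n x, x (n + 1)) ∂markovChain K s =
      ∫⁻ x, ∫⁻ z, f (Preorder.frestrictLe n x, z) ∂K (x n) ∂markovChain K s := by
  have key := Kernel.partialTraj_compProd_eq_map_traj (X := fun _ => S)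
    (κ := fun n => K.comap (fun h : (i : Finset.Iic n) → S => h ⟨n, by simp⟩)
      (measurable_pi_apply _)) (Nat.zero_le n) (x₀ := fun _ => s)
  have h1 : Measurable fun x : ℕ → S => (Preorder.frestrictLe (π := fun _ => S) n x, x (n + 1)) :=
    by fun_prop
  rw [markovChain, Kernel.comap_apply, ← lintegral_map hf h1, ← key,
    Measure.lintegral_compProd hf, ← Kernel.traj_map_frestrictLe_apply,
    lintegral_map _ (Preorder.measurable_frestrictLe n)]
  · rfl
  · exact hf.lintegral_kernel_prod_right'

theorem ae_markovChain_zero [MeasurableSingletonClass S] (s : S) :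
    ∀ᵐ x ∂markovChain K s, x 0 = s := by
  rw [markovChain, Kernel.comap_apply]
  have h := Kernel.traj_map_frestrictLe_apply (X := fun _ => S)
    (κ := fun n => K.comap (fun h : (i : Finset.Iic n) → S => h ⟨n, by simp⟩)
      (measurable_pi_apply _)) 0 0 (fun _ => s)
  rw [Kernel.partialTraj_self, Kernel.id_apply] at h
  have hm : MeasurableSet {y : Finset.Iic 0 → S | y ⟨0, by simp⟩ = s} :=
    (measurableSet_singleton s).preimage (measurable_pi_apply _)
  have h2 : ∀ᵐ y ∂(Measure.dirac (fun _ : Finset.Iic 0 => s)), y ⟨0, by simp⟩ = s := by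
    rw [ae_dirac_iff hm]
  rw [← h] at h2
  exact ae_of_ae_map (Preorder.measurable_frestrictLe 0).aemeasurable h2

open Classical in
/-- If `h` is superharmonic off `A` and at least `1` on `A`, then the probability of visiting `A`
at a positive time is at most the mean of `h` after one step. -/
theorem markovChain_hit_le {A : Set S} (hA : MeasurableSet A) {h : S → ℝ≥0∞} (hh : Measurable h)
    (h1 : ∀ s ∈ A, 1 ≤ h s) (hK : ∀ s ∉ A, ∫⁻ z, h z ∂K s ≤ h s) (s : S) :
    markovChain K s {x | ∃ n, 1 ≤ n ∧ x n ∈ A} ≤ ∫⁻ z, h z ∂K s := by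
  let H : ℕ → Set (ℕ → S) := fun n => {x | ∃ k, 1 ≤ k ∧ k ≤ n ∧ x k ∈ A}
  -- `F` follows `h` along the chain and is frozen at 1 once `A` has been hit at a positive time.
  -- Its mean is nonincreasing from time 1 on and dominates the probability of `H n`.
  let F : ℕ → (ℕ → S) → ℝ≥0∞ := fun n x => if x ∈ H n then 1 else h (x n)
  have hH : ∀ n, MeasurableSet (H n) := by
    intro n
    have : H n = ⋃ k ∈ Finset.Icc 1 n, (fun x : ℕ → S => x k) ⁻¹' A := by
      ext x
      simp [H, and_assoc]
    rw [this]
    exact Finset.measurableSet_biUnion _ fun k _ => hA.preimage (measurable_pi_apply k)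
  have hstep : ∀ n, 1 ≤ n →
      ∫⁻ x, F (n + 1) x ∂markovChain K s ≤ ∫⁻ x, F n x ∂markovChain K s := by
    intro n hn
    -- `B` is `H n` read off the history up to time `n`, the form in which the Markov property
    -- applies.
    let B : Set (Finset.Iic n → S) := {y | ∃ k : Finset.Iic n, 1 ≤ k.1 ∧ y k ∈ A}
    have hB : MeasurableSet B := by
      have : B = ⋃ k : Finset.Iic n, ⋃ _ : 1 ≤ k.1, (fun y : Finset.Iic n → S => y k) ⁻¹' A := by
        ext y
        simp [B]
      rw [this]
      exact MeasurableSet.iUnion fun k => MeasurableSet.iUnion fun _ =>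
        hA.preimage (measurable_pi_apply k)
    have hBH : ∀ x : ℕ → S, Preorder.frestrictLe (π := fun _ => S) n x ∈ B ↔ x ∈ H n := by
      intro x
      constructor
      · rintro ⟨⟨k, hk⟩, hk1, hkA⟩
        exact ⟨k, hk1, Finset.mem_Iic.1 hk, hkA⟩
      · rintro ⟨k, hk1, hkn, hkA⟩
        exact ⟨⟨k, Finset.mem_Iic.2 hkn⟩, hk1, hkA⟩
    let f : ((Finset.Iic n → S) × S) → ℝ≥0∞ := fun q => if q.1 ∈ B then 1 else h q.2
    have hf : Measurable f :=
      Measurable.ite (hB.preimage measurable_fst) measurable_const (hh.comp measurable_snd)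
    calc ∫⁻ x, F (n + 1) x ∂markovChain K s
        ≤ ∫⁻ x, f (Preorder.frestrictLe n x, x (n + 1)) ∂markovChain K s := by
          refine lintegral_mono fun x => ?_
          simp only [F, f, hBH]
          by_cases hx : x ∈ H n
          · have hx' : x ∈ H (n + 1) := by
              obtain ⟨k, hk⟩ := hx
              exact ⟨k, hk.1, hk.2.1.trans n.le_succ, hk.2.2⟩
            simp [hx, hx']
          · by_cases hx' : x ∈ H (n + 1)
            · obtain ⟨k, hk1, hkn, hkA⟩ := id hx'
              have hk : k = n + 1 := by
                by_contra hne
                exact hx ⟨k, hk1, by omega, hkA⟩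
              subst hk
              -- A first hit at time `n + 1` replaces `h (x (n + 1)) ≥ 1` by 1, which only lowers
              -- the value.
              simp [hx, hx', h1 _ hkA]
            · simp [hx, hx']
      _ = ∫⁻ x, ∫⁻ z, f (Preorder.frestrictLe n x, z) ∂K (x n) ∂markovChain K s :=
          lintegral_markovChain_succ K s n hf
      _ ≤ ∫⁻ x, F n x ∂markovChain K s := by
          refine lintegral_mono fun x => ?_
          simp only [F, f, hBH]
          by_cases hx : x ∈ H n
          · simp [hx]
          · simp only [hx, if_false]
            -- Since `1 ≤ n`, no hit so far forces `x n ∉ A`, where `h` is superharmonic.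
            exact hK _ fun hxA => hx ⟨n, hn, le_rfl, hxA⟩
  have hF : ∀ n, 1 ≤ n → ∫⁻ x, F n x ∂markovChain K s ≤ ∫⁻ z, h z ∂K s := by
    intro n hn
    induction n, hn using Nat.le_induction with
    | base =>
      rw [← lintegral_markovChain_one K s hh]
      refine lintegral_mono fun x => ?_
      simp only [F]
      split_ifs with hx
      · obtain ⟨k, hk1, hkn, hkA⟩ := hx
        obtain rfl : k = 1 := le_antisymm hkn hk1
        exact h1 _ hkA
      · exact le_rfl
    | succ n hn ih => exact (hstep n hn).trans ih
  have hU : {x : ℕ → S | ∃ n, 1 ≤ n ∧ x n ∈ A} = ⋃ n, H n := by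
    ext x
    simp only [Set.mem_ofPred_eq, Set.mem_iUnion, H]
    exact ⟨fun ⟨n, hn, hx⟩ => ⟨n, n, hn, le_rfl, hx⟩, fun ⟨_, k, hk, _, hx⟩ => ⟨k, hk, hx⟩⟩
  have hmono : Monotone H := fun a b hab x ⟨k, hk1, hk, hx⟩ => ⟨k, hk1, hk.trans hab, hx⟩
  rw [hU, hmono.measure_iUnion]
  refine iSup_le fun n => ?_
  calc markovChain K s (H n) ≤ markovChain K s (H (n + 1)) := measure_mono (hmono n.le_succ)
    _ = ∫⁻ x, (H (n + 1)).indicator 1 x ∂markovChain K s := (lintegral_indicator_one (hH _)).symm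
    _ ≤ ∫⁻ x, F (n + 1) x ∂markovChain K s := by
        refine lintegral_mono fun x => ?_
        by_cases hx : x ∈ H (n + 1) <;> simp [F, hx]
    _ ≤ _ := hF _ (by omega)

end MarkovChain

/-! ### Escape bounds for the biased walk -/

theorem lintegral_stepMeasure (lam : ℝ≥0) (x : List ℕ) (k : ℕ) (h : List ℕ → ℝ≥0∞) :
    ∫⁻ z, h z ∂stepMeasure lam x k =
      if k = 0 then h x
      else if x = [] then ∑ i ∈ Finset.range k, ((1 / (k : ℝ≥0) : ℝ≥0) : ℝ≥0∞) * h [i]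
      else ((lam / (k + lam) : ℝ≥0) : ℝ≥0∞) * h x.dropLast
        + ∑ i ∈ Finset.range k, ((1 / (k + lam) : ℝ≥0) : ℝ≥0∞) * h (x ++ [i]) := by
  unfold stepMeasure
  split_ifs
  · rw [lintegral_dirac]
  · simp only [lintegral_finsetSum_measure, lintegral_smul_measure, ENNReal.smul_def, smul_eq_mul,
      lintegral_dirac]
  · simp only [lintegral_add_measure, lintegral_finsetSum_measure, lintegral_smul_measure,
      ENNReal.smul_def, smul_eq_mul, lintegral_dirac]

/-- With `k ≥ 1` children one step multiplies the mean by `(1 + k lam) / (k + lam)`, which is at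
most 1 because `(k - 1)(1 - lam) ≥ 0`. Words with `k = 0` are absorbing and give equality. -/
theorem lintegral_stepMeasure_pow_le {lam : ℝ≥0} (hlam : lam ≤ 1) {x : List ℕ} (hx : x ≠ [])
    (k : ℕ) :
    ∫⁻ z, ((lam ^ z.length : ℝ≥0) : ℝ≥0∞) ∂stepMeasure lam x k ≤
      ((lam ^ x.length : ℝ≥0) : ℝ≥0∞) := by
  rw [lintegral_stepMeasure]
  split_ifs with hk
  · exact le_rfl
  obtain ⟨l, hl⟩ : ∃ l, x.length = l + 1 :=
    ⟨x.length - 1, by have := List.length_pos_of_ne_nil hx; omega⟩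
  simp only [List.length_dropLast, List.length_append, List.length_singleton, hl,
    Nat.add_sub_cancel, Finset.sum_const, Finset.card_range, nsmul_eq_mul]
  norm_cast
  have hk1 : (1 : ℝ≥0) ≤ k := by exact_mod_cast Nat.one_le_iff_ne_zero.2 hk
  have hpos : (0 : ℝ≥0) < k + lam := by positivity
  have e : lam / (k + lam) * lam ^ l + k * (1 / (k + lam) * lam ^ (l + 1 + 1)) =
      lam ^ (l + 1) * ((1 + k * lam) / (k + lam)) := by
    field_simp
    ring
  rw [e]
  refine mul_le_of_le_one_right' ?_
  rw [div_le_one hpos, ← NNReal.coe_le_coe]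
  have h1 : (1 : ℝ) ≤ k := by exact_mod_cast hk1
  have h2 : (lam : ℝ) ≤ 1 := by exact_mod_cast hlam
  push_cast
  nlinarith

theorem lintegral_stepMeasure_nil_pow (lam : ℝ≥0) {k : ℕ} (hk : k ≠ 0) :
    ∫⁻ z, ((lam ^ z.length : ℝ≥0) : ℝ≥0∞) ∂stepMeasure lam [] k = lam := by
  rw [lintegral_stepMeasure, if_neg hk, if_pos rfl]
  simp only [List.length_singleton, pow_one, Finset.sum_const, Finset.card_range, nsmul_eq_mul]
  have hk' : (k : ℝ≥0) ≠ 0 := by exact_mod_cast hk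
  have e : (k : ℝ≥0) * (1 / k * lam) = lam := by field_simp
  have e' := congrArg (fun r : ℝ≥0 => (r : ℝ≥0∞)) e
  simp only [ENNReal.coe_mul, ENNReal.coe_natCast] at e'
  exact e'

theorem lintegral_envKernel (lam : ℝ≥0) (q : LeaflessTree × List ℕ) {h : List ℕ → ℝ≥0∞} :
    ∫⁻ z, h z.2 ∂envKernel lam q = ∫⁻ z, h z ∂stepMeasure lam q.2 (q.1.children q.2) := by
  have hh : Measurable h := measurable_of_countable h
  rw [envKernel, Kernel.lintegral_prod _ _ _ (g := fun z => h z.2)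
    (hh.comp measurable_snd), Kernel.lintegral_deterministic']
  · rfl
  · exact (measurable_const : Measurable fun _ : LeaflessTree => ∫⁻ c, h c ∂posKernel lam q)

theorem measurable_trajectory_snd :
    Measurable fun (w : ℕ → LeaflessTree × List ℕ) (n : ℕ) => (w n).2 :=
  measurable_pi_lambda _ fun n => measurable_snd.comp (measurable_pi_apply n)

instance instIsMarkovKernelWalk (lam : ℝ≥0) : IsMarkovKernel (walk lam) := by
  unfold walk
  exact Kernel.IsMarkovKernel.map _
    measurable_trajectory_snd

theorem walk_apply (lam : ℝ≥0) (q : LeaflessTree × List ℕ) :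
    walk lam q = (markovChain (envKernel lam) q).map fun w n => (w n).2 :=
  Kernel.map_apply _
    measurable_trajectory_snd _

theorem measurableSet_return : MeasurableSet {X : ℕ → List ℕ | ∃ n, 1 ≤ n ∧ X n = []} := by
  have : {X : ℕ → List ℕ | ∃ n, 1 ≤ n ∧ X n = []} =
      ⋃ n, ⋃ _ : 1 ≤ n, (fun X : ℕ → List ℕ => X n) ⁻¹' {[]} := by
    ext X
    simp
  rw [this]
  exact MeasurableSet.iUnion fun n => MeasurableSet.iUnion fun _ =>
    (measurableSet_singleton _).preimage (measurable_pi_apply n)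

/-- The hitting estimate with the root as target and `lam ^ |x|` as superharmonic function. -/
theorem walk_return_le {lam : ℝ≥0} (hlam : lam ≤ 1) (q : LeaflessTree × List ℕ) :
    walk lam q {X | ∃ n, 1 ≤ n ∧ X n = []} ≤
      ∫⁻ z, ((lam ^ z.length : ℝ≥0) : ℝ≥0∞) ∂stepMeasure lam q.2 (q.1.children q.2) := by
  rw [walk_apply, Measure.map_apply
    measurable_trajectory_snd
    measurableSet_return, ← lintegral_envKernel]
  have hc : Measurable fun z : List ℕ => ((lam ^ z.length : ℝ≥0) : ℝ≥0∞) :=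
    measurable_of_countable _
  refine markovChain_hit_le (envKernel lam) (A := {q | q.2 = []})
    (h := fun z => ((lam ^ z.2.length : ℝ≥0) : ℝ≥0∞))
    ((measurableSet_singleton []).preimage measurable_snd) (hc.comp measurable_snd) ?_ ?_ q
  · rintro ⟨T, x⟩ rfl
    simp
  · intro s hs
    rw [lintegral_envKernel lam s (h := fun z => ((lam ^ z.length : ℝ≥0) : ℝ≥0∞))]
    exact lintegral_stepMeasure_pow_le hlam hs _

theorem ae_walk_zero (lam : ℝ≥0) (T : LeaflessTree) (x : List ℕ) :
    ∀ᵐ X ∂walk lam (T, x), X 0 = x := by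
  rw [walk_apply, ae_map_iff (p := fun X : ℕ → List ℕ => X 0 = x)
    measurable_trajectory_snd.aemeasurable
    ((measurableSet_singleton x).preimage (measurable_pi_apply 0))]
  filter_upwards [ae_markovChain_zero (envKernel lam) (T, x)] with w hw
  rw [hw]

theorem one_sub_le_measureReal_no_return {lam : ℝ≥0} {q : LeaflessTree × List ℕ}
    (h : walk lam q {X | ∃ n, 1 ≤ n ∧ X n = []} ≤ lam) :
    1 - (lam : ℝ) ≤ (walk lam q).real {X | ∀ n, 1 ≤ n → X n ≠ []} := by
  have e : {X : ℕ → List ℕ | ∀ n, 1 ≤ n → X n ≠ []} = {X | ∃ n, 1 ≤ n ∧ X n = []}ᶜ := by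
    ext X
    simp
  rw [e, probReal_compl_eq_one_sub measurableSet_return]
  have := ENNReal.toReal_mono ENNReal.coe_ne_top h
  rw [ENNReal.coe_toReal] at this
  exact sub_le_sub_left this 1

/-- The walk on `T_*` starts at level 1, where the superharmonic function has value `lam`. -/
theorem one_sub_le_escapeProb {lam : ℝ≥0} (hlam : lam ≤ 1) (T : LeaflessTree) :
    1 - (lam : ℝ) ≤ escapeProb lam T := by
  have h : walk lam (addParent T, [0]) {X | ∃ n, 1 ≤ n ∧ X n = []} ≤ lam := by
    refine (walk_return_le hlam _).trans ?_
    simpa using lintegral_stepMeasure_pow_le hlam (x := [0]) (by simp)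
      ((addParent T).children [0])
  refine (one_sub_le_measureReal_no_return h).trans ?_
  unfold escapeProb
  refine ENNReal.toReal_mono (measure_ne_top _ _) (measure_mono_ae ?_)
  -- The escape event also constrains time 0, where the walk is almost surely at `[0] ≠ []`.
  filter_upwards [ae_walk_zero lam (addParent T) [0]] with X hX h n
  rcases Nat.eq_zero_or_pos n with rfl | hn
  · rw [hX]
    simp
  · exact h n hn

theorem escapeProb_le_one (lam : ℝ≥0) (T : LeaflessTree) : escapeProb lam T ≤ 1 :=
  measureReal_le_one

/-- The first step from the root always leads to level 1, so the return probability is again at most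
`lam`. -/
theorem children_mul_le_effConductance {lam : ℝ≥0} (hlam : lam ≤ 1) (T : LeaflessTree) :
    T.children [] * (1 - (lam : ℝ)) ≤ effConductance lam T := by
  have h : walk lam (T, []) {X | ∃ n, 1 ≤ n ∧ X n = []} ≤ lam :=
    (walk_return_le hlam _).trans
      (lintegral_stepMeasure_nil_pow lam (k := T.children []) T.2.1.ne').le
  have := one_sub_le_measureReal_no_return h
  simp only [effConductance, edgeConductance, pow_zero, inv_one, Finset.sum_const,
    Finset.card_range, nsmul_eq_mul, mul_one]
  gcongr

theorem effConductance_le_children (lam : ℝ≥0) (T : LeaflessTree) :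
    effConductance lam T ≤ T.children [] := by
  simp only [effConductance, edgeConductance, pow_zero, inv_one, Finset.sum_const,
    Finset.card_range, nsmul_eq_mul, mul_one]
  exact mul_le_of_le_one_right (Nat.cast_nonneg _) measureReal_le_one

theorem agwWeight_bounds {lam : ℝ≥0} (hlam : lam < 1) (T T' : LeaflessTree) :
    1 - (lam : ℝ) ≤ agwWeight lam T T' ∧
      agwWeight lam T T' ≤ (1 + (lam : ℝ)) / (1 - lam) := by
  have hl0 : (0 : ℝ) ≤ lam := lam.2
  have hl1 : (lam : ℝ) < 1 := by exact_mod_cast hlam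
  have hb1 := one_sub_le_escapeProb hlam.le T
  have hb2 := escapeProb_le_one lam T
  have hc1 := children_mul_le_effConductance hlam.le T'
  have hc2 := effConductance_le_children lam T'
  have hk : (1 : ℝ) ≤ T'.children [] := by exact_mod_cast T'.2.1
  unfold agwWeight
  set b := escapeProb lam T
  set c := effConductance lam T'
  set k : ℝ := (T'.children [] : ℝ)
  have hkpos : 0 < k * (1 - (lam : ℝ)) := by nlinarith
  -- As `b ≥ 1 - lam`, the denominator is at least `c ≥ k (1 - lam)`; as `b ≤ 1` and `c ≤ k`, it is
  -- at most `lam + k`.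
  have hden : 0 < (lam : ℝ) - 1 + b + c := by linarith
  constructor
  · rw [le_div_iff₀ hden]
    calc (1 - (lam : ℝ)) * (lam - 1 + b + c) ≤ (1 - lam) * (lam + k) := by
          gcongr
          linarith
      _ ≤ (lam + k) * b := by nlinarith
  · rw [div_le_div_iff₀ hden (by linarith)]
    have h1 : ((lam : ℝ) + k) * b ≤ (lam + k) * 1 := by gcongr
    -- Leaflessness enters as `k ≥ 1`; it makes the upper bound independent of `k`.
    have h2 : (lam : ℝ) + k ≤ (1 + lam) * k := by nlinarith
    calc ((lam : ℝ) + k) * b * (1 - lam) ≤ ((1 + lam) * k) * (1 - lam) := by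
          exact mul_le_mul_of_nonneg_right (by linarith) (by linarith)
      _ = (1 + lam) * (k * (1 - lam)) := by ring
      _ ≤ (1 + lam) * (lam - 1 + b + c) := by
          gcongr
          linarith

end BiasedWalk

namespace BiasedWalk

/-! ### Measurability of the marked tree -/

theorem measurable_children (x : List ℕ) : Measurable fun T : LeaflessTree => T.children x :=
  (measurable_pi_apply x).comp measurable_subtype_coe

theorem measurable_treeOfLabels : Measurable treeOfLabels := by
  refine Measurable.subtype_mk (measurable_pi_lambda _ fun x => ?_)
  induction x with
  | nil => exact measurable_const.max (measurable_pi_apply [])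
  | cons i x ih =>
    refine Measurable.ite (measurableSet_lt measurable_const
      (measurable_const.max (measurable_pi_apply []))) (ih.comp ?_) measurable_const
    exact measurable_pi_lambda _ fun y => measurable_pi_apply (i :: y)

theorem measurable_join : Measurable fun q : LeaflessTree × LeaflessTree => join q.1 q.2 := by
  refine Measurable.subtype_mk (measurable_pi_lambda _ fun x => ?_)
  rcases x with _ | ⟨_ | i, x⟩
  · exact ((measurable_children []).comp measurable_snd).add_const 1
  · exact (measurable_children x).comp measurable_fst
  · exact (measurable_children (i :: x)).comp measurable_snd

/-- Evaluation at a random time is measurable because time is countable. -/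
theorem measurable_eval_comp {α : Type*} [MeasurableSpace α] {X : α → ℕ → List ℕ} {τ : α → ℕ}
    (hX : Measurable X) (hτ : Measurable τ) : Measurable fun a => X a (τ a) := by
  have h : Measurable fun q : ℕ × (ℕ → List ℕ) => q.2 q.1 :=
    measurable_from_prod_countable_right fun n => measurable_pi_apply n
  exact h.comp (hτ.prodMk hX)

/-- Exhibits the last visit as a countable supremum of measurable functions. In `ℕ` the supremum of
an empty or unbounded set is 0, so the identity also covers vertices visited never or infinitely
often. -/
theorem lastVisit_eq_iSup (X : ℕ → List ℕ) (x : List ℕ) :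
    lastVisit X x = ⨆ n, if X n = x then n else 0 := by
  unfold lastVisit
  by_cases hb : BddAbove {n | X n = x}
  · have hb' : BddAbove (Set.range fun n => if X n = x then n else 0) := by
      obtain ⟨B, hB⟩ := hb
      refine ⟨B, ?_⟩
      rintro _ ⟨n, rfl⟩
      dsimp only
      split_ifs with h
      · exact hB h
      · exact Nat.zero_le _
    refine le_antisymm ?_ (ciSup_le fun n => ?_)
    · rcases Set.eq_empty_or_nonempty {n | X n = x} with he | hne
      · simp [he]
      · refine csSup_le hne fun n hn => ?_
        have := le_ciSup hb' n
        simpa only [if_pos (show X n = x from hn)] using this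
    · split_ifs with h
      · exact le_csSup hb h
      · exact Nat.zero_le _
  · have hb' : ¬ BddAbove (Set.range fun n => if X n = x then n else 0) := by
      rintro ⟨B, hB⟩
      refine hb ⟨B, fun n hn => ?_⟩
      have := hB ⟨n, rfl⟩
      simpa only [if_pos (show X n = x from hn)] using this
    rw [Nat.sSup_of_not_bddAbove hb, iSup, Nat.sSup_of_not_bddAbove hb']

theorem measurable_lastVisit (x : List ℕ) : Measurable fun X : ℕ → List ℕ => lastVisit X x := by
  simp only [lastVisit_eq_iSup]
  exact Measurable.iSup fun n => Measurable.ite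
    ((measurableSet_singleton x).preimage (measurable_pi_apply n)) measurable_const
    measurable_const

theorem measurable_loopErase : Measurable loopErase := by
  refine measurable_pi_lambda _ fun n => ?_
  induction n with
  | zero => exact measurable_pi_apply 0
  | succ n ih =>
    have h : Measurable fun q : List ℕ × (ℕ → List ℕ) => lastVisit q.2 q.1 :=
      measurable_from_prod_countable_right fun x => measurable_lastVisit x
    exact measurable_eval_comp (X := fun Y : ℕ → List ℕ => Y) measurable_id ((h.comp (ih.prodMk measurable_id)).add_const 1)

theorem measurableSet_isRay :
    MeasurableSet {q : LeaflessTree × (ℕ → List ℕ) | IsRay q.1 q.2} := by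
  have hξ : ∀ n, Measurable fun q : LeaflessTree × (ℕ → List ℕ) => q.2 n := fun n =>
    (measurable_pi_apply n).comp measurable_snd
  have hc : Measurable fun q : List ℕ × LeaflessTree => q.2.children q.1 :=
    measurable_from_prod_countable_right fun x => measurable_children x
  have hch : ∀ n, Measurable fun q : LeaflessTree × (ℕ → List ℕ) => q.1.children (q.2 n) :=
    fun n => hc.comp ((hξ n).prodMk measurable_fst)
  have e : {q : LeaflessTree × (ℕ → List ℕ) | IsRay q.1 q.2} =
      {q | q.2 0 = []} ∩ ⋂ n, ⋃ i : ℕ, ({q | i < q.1.children (q.2 n)} ∩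
        {q | q.2 (n + 1) = q.2 n ++ [i]}) := by
    ext q
    simp [IsRay]
  rw [e]
  refine ((measurableSet_singleton []).preimage (hξ 0)).inter
    (MeasurableSet.iInter fun n => MeasurableSet.iUnion fun i => ?_)
  exact (measurableSet_lt measurable_const (hch n)).inter
    (measurableSet_eq_fun (hξ (n + 1)) ((measurable_of_countable (· ++ [i])).comp (hξ n)))

theorem measurable_harmonicRay :
    Measurable fun q : LeaflessTree × (ℕ → List ℕ) => harmonicRay q.1 q.2 := by
  unfold harmonicRay
  refine Measurable.ite ?_ (measurable_loopErase.comp measurable_snd) measurable_const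
  exact measurableSet_isRay.preimage
    (measurable_fst.prodMk (measurable_loopErase.comp measurable_snd))

theorem measurable_prolong : Measurable prolong := by
  refine measurable_pi_lambda _ fun n => ?_
  rcases n with _ | n
  · exact measurable_const
  · exact (measurable_of_countable (List.cons 0)).comp (measurable_pi_apply n)

theorem measurable_markedJoin : Measurable markedJoin := by
  refine Measurable.subtype_mk ((measurable_join.comp measurable_fst).prodMk
    (measurable_prolong.comp (measurable_harmonicRay.comp
      ((measurable_fst.comp measurable_fst).prodMk measurable_snd))))

theorem measurable_nuPlus : Measurable nuPlus := by
  have h : Measurable fun τ : MarkedTree => τ.1.1.children [] :=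
    (measurable_children []).comp (measurable_fst.comp measurable_subtype_coe)
  exact ((measurable_of_countable (Nat.cast : ℕ → ℝ)).comp h).sub_const 1

/-- The child added by the joining edge cancels the subtracted 1. -/
theorem nuPlus_markedJoin (w : (LeaflessTree × LeaflessTree) × (ℕ → List ℕ)) :
    nuPlus (markedJoin w) = w.1.2.children [] := by
  change ((w.1.2.children [] + 1 : ℕ) : ℝ) - 1 = _
  push_cast
  ring

/-! ### The reference law -/

instance instIsProbabilityMeasureGw (p : PMF ℕ) : IsProbabilityMeasure (gw p) :=
  Measure.isProbabilityMeasure_map measurable_treeOfLabels.aemeasurable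

instance instIsProbabilityMeasureBaseLaw (p : PMF ℕ) (lam : ℝ≥0) :
    IsProbabilityMeasure (baseLaw p lam) := by
  unfold baseLaw
  infer_instance

/-- The root has `max 1 k` children when its label is `k`; this differs from `k` only at `k = 0`,
which has no mass. -/
theorem lintegral_children_gw {p : PMF ℕ} (hp0 : p 0 = 0) {m : ℝ}
    (hm : HasSum (fun k : ℕ => (k : ℝ) * (p k).toReal) m) :
    ∫⁻ T, (T.children [] : ℝ≥0∞) ∂gw p = ENNReal.ofReal m := by
  have hc : Measurable fun T : LeaflessTree => (T.children [] : ℝ≥0∞) :=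
    (measurable_of_countable (Nat.cast : ℕ → ℝ≥0∞)).comp (measurable_children [])
  have hc' : Measurable fun k : ℕ => ((max 1 k : ℕ) : ℝ≥0∞) := measurable_of_countable _
  rw [gw, lintegral_map hc measurable_treeOfLabels]
  change ∫⁻ g : List ℕ → ℕ, ((max 1 (g []) : ℕ) : ℝ≥0∞) ∂_ = _
  rw [(measurePreserving_eval_infinitePi (fun _ : List ℕ => p.toMeasure) []).lintegral_comp hc',
    lintegral_countable', ← hm.tsum_eq,
    ENNReal.ofReal_tsum_of_nonneg (fun k => by positivity) hm.summable]
  refine tsum_congr fun k => ?_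
  rw [PMF.toMeasure_apply_singleton _ _ (measurableSet_singleton k)]
  rcases Nat.eq_zero_or_pos k with rfl | hk
  · simp [hp0]
  · rw [max_eq_right hk, ENNReal.ofReal_mul (Nat.cast_nonneg _), ENNReal.ofReal_natCast,
      ENNReal.ofReal_toReal (p.apply_ne_top k)]

/-- Only the marginal of `T⁺` matters, so neither the walk nor `lam` affects the mean. -/
theorem lintegral_nuPlus_map_markedJoin {p : PMF ℕ} (hp0 : p 0 = 0) {m : ℝ}
    (hm : HasSum (fun k : ℕ => (k : ℝ) * (p k).toReal) m) (lam : ℝ≥0) :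
    ∫⁻ τ, ENNReal.ofReal (nuPlus τ) ∂(baseLaw p lam).map markedJoin = ENNReal.ofReal m := by
  have hc : Measurable fun T : LeaflessTree => (T.children [] : ℝ≥0∞) :=
    (measurable_of_countable (Nat.cast : ℕ → ℝ≥0∞)).comp (measurable_children [])
  rw [lintegral_map measurable_nuPlus.ennreal_ofReal measurable_markedJoin]
  simp only [nuPlus_markedJoin, ENNReal.ofReal_natCast]
  rw [← lintegral_map (μ := baseLaw p lam) (f := fun q => (q.2.children [] : ℝ≥0∞))
      (hc.comp measurable_snd) measurable_fst]
  have h1 : (baseLaw p lam).map Prod.fst = (gw p).prod (gw p) := Measure.fst_compProd _ _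
  rw [h1, ← lintegral_map hc measurable_snd]
  have h2 : ((gw p).prod (gw p)).map Prod.snd = gw p := Measure.snd_prod
  rw [h2, lintegral_children_gw hp0 hm]

/-! ### Comparison of the augmented measure with the reference law -/

theorem agwConst_bounds (p : PMF ℕ) {lam : ℝ≥0} (hlam : lam < 1) :
    ENNReal.ofReal (1 - lam) ≤ agwConst p lam ∧
      agwConst p lam ≤ ENNReal.ofReal ((1 + lam) / (1 - lam)) := by
  unfold agwConst
  constructor
  · calc ENNReal.ofReal (1 - lam) = ∫⁻ _, ENNReal.ofReal (1 - lam) ∂baseLaw p lam := by simp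
      _ ≤ _ := lintegral_mono fun w =>
        ENNReal.ofReal_le_ofReal (agwWeight_bounds hlam w.1.1 w.1.2).1
  · calc _ ≤ ∫⁻ _, ENNReal.ofReal ((1 + lam) / (1 - lam)) ∂baseLaw p lam :=
          lintegral_mono fun w =>
            ENNReal.ofReal_le_ofReal (agwWeight_bounds hlam w.1.1 w.1.2).2
      _ = _ := by simp

theorem agwConst_ne_zero (p : PMF ℕ) {lam : ℝ≥0} (hlam : lam < 1) : agwConst p lam ≠ 0 := by
  have h : 0 < ENNReal.ofReal (1 - lam) :=
    ENNReal.ofReal_pos.2 (sub_pos.2 (by exact_mod_cast hlam))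
  exact (h.trans_le (agwConst_bounds p hlam).1).ne'

theorem agwConst_ne_top (p : PMF ℕ) {lam : ℝ≥0} (hlam : lam < 1) : agwConst p lam ≠ ∞ :=
  ((agwConst_bounds p hlam).2.trans_lt ENNReal.ofReal_lt_top).ne

theorem isProbabilityMeasure_agw (p : PMF ℕ) {lam : ℝ≥0} (hlam : lam < 1) :
    IsProbabilityMeasure (agw p lam) := by
  constructor
  rw [agw, Measure.map_apply measurable_markedJoin .univ, Set.preimage_univ,
    withDensity_apply _ .univ, Measure.restrict_univ,
    lintegral_const_mul' _ _ (ENNReal.inv_ne_top.2 (agwConst_ne_zero p hlam))]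
  exact ENNReal.inv_mul_cancel (agwConst_ne_zero p hlam) (agwConst_ne_top p hlam)

/-- The ratio of the upper to the lower bound of the unnormalised density. -/
noncomputable def distortion (lam : ℝ≥0) : ℝ := (1 + lam) / (1 - lam) ^ 2

theorem distortion_pos {lam : ℝ≥0} (hlam : lam < 1) : 0 < distortion lam := by
  have h : (0 : ℝ) < 1 - lam := sub_pos.2 (by exact_mod_cast hlam)
  unfold distortion
  positivity

/-- Combines the upper bound on the weight with the lower bound on the normalising constant;
`le_agw` uses the opposite pair. -/
theorem agw_le (p : PMF ℕ) {lam : ℝ≥0} (hlam : lam < 1) :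
    agw p lam ≤ ENNReal.ofReal (distortion lam) • (baseLaw p lam).map markedJoin := by
  have h : (0 : ℝ) < 1 - lam := sub_pos.2 (by exact_mod_cast hlam)
  rw [← Measure.map_smul, ← withDensity_const, agw]
  refine Measure.map_mono (withDensity_mono (ae_of_all _ fun w => ?_)) measurable_markedJoin
  have e : distortion lam = (1 - (lam : ℝ))⁻¹ * ((1 + lam) / (1 - lam)) := by
    unfold distortion
    field_simp
  rw [e, ENNReal.ofReal_mul (by positivity), ENNReal.ofReal_inv_of_pos h]
  exact mul_le_mul' (ENNReal.inv_le_inv.2 (agwConst_bounds p hlam).1)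
    (ENNReal.ofReal_le_ofReal (agwWeight_bounds hlam _ _).2)

theorem le_agw (p : PMF ℕ) {lam : ℝ≥0} (hlam : lam < 1) :
    ENNReal.ofReal (distortion lam)⁻¹ • (baseLaw p lam).map markedJoin ≤ agw p lam := by
  have h : (0 : ℝ) < 1 - lam := sub_pos.2 (by exact_mod_cast hlam)
  rw [← Measure.map_smul, ← withDensity_const, agw]
  refine Measure.map_mono (withDensity_mono (ae_of_all _ fun w => ?_)) measurable_markedJoin
  have e : (distortion lam)⁻¹ = ((1 + (lam : ℝ)) / (1 - lam))⁻¹ * (1 - lam) := by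
    unfold distortion
    field_simp
  rw [e, ENNReal.ofReal_mul (by positivity), ENNReal.ofReal_inv_of_pos (by positivity)]
  exact mul_le_mul' (ENNReal.inv_le_inv.2 (agwConst_bounds p hlam).2)
    (ENNReal.ofReal_le_ofReal (agwWeight_bounds hlam _ _).1)

theorem nuPlus_nonneg (τ : MarkedTree) : 0 ≤ nuPlus τ := by
  have h : (1 : ℝ) ≤ τ.1.1.children [] := by exact_mod_cast τ.1.1.2.1
  unfold nuPlus
  linarith

theorem lintegral_nuPlus_le {p : PMF ℕ} (hp0 : p 0 = 0) {m : ℝ}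
    (hm : HasSum (fun k : ℕ => (k : ℝ) * (p k).toReal) m) {lam : ℝ≥0} (hlam : lam < 1) :
    ∫⁻ τ, ENNReal.ofReal (nuPlus τ) ∂agw p lam ≤ ENNReal.ofReal (distortion lam * m) := by
  refine (lintegral_mono' (agw_le p hlam) le_rfl).trans ?_
  rw [lintegral_smul_measure, lintegral_nuPlus_map_markedJoin hp0 hm, smul_eq_mul,
    ENNReal.ofReal_mul (distortion_pos hlam).le]

theorem le_lintegral_nuPlus {p : PMF ℕ} (hp0 : p 0 = 0) {m : ℝ}
    (hm : HasSum (fun k : ℕ => (k : ℝ) * (p k).toReal) m) {lam : ℝ≥0} (hlam : lam < 1) :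
    ENNReal.ofReal ((distortion lam)⁻¹ * m) ≤ ∫⁻ τ, ENNReal.ofReal (nuPlus τ) ∂agw p lam := by
  refine le_trans ?_ (lintegral_mono' (le_agw p hlam) le_rfl)
  rw [lintegral_smul_measure, lintegral_nuPlus_map_markedJoin hp0 hm, smul_eq_mul,
    ENNReal.ofReal_mul (inv_nonneg.2 (distortion_pos hlam).le)]

/-- Domination by a finite multiple of the unweighted law reduces integrability to the finite
offspring mean. -/
theorem integrable_nuPlus_agw {p : PMF ℕ} (hp0 : p 0 = 0) {m : ℝ}
    (hm : HasSum (fun k : ℕ => (k : ℝ) * (p k).toReal) m) {lam : ℝ≥0} (hlam : lam < 1) :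
    Integrable nuPlus (agw p lam) := by
  refine ⟨measurable_nuPlus.aestronglyMeasurable, ?_⟩
  rw [hasFiniteIntegral_iff_ofReal (ae_of_all _ nuPlus_nonneg)]
  exact (lintegral_nuPlus_le hp0 hm hlam).trans_lt ENNReal.ofReal_lt_top

theorem integral_nuPlus_bounds {p : PMF ℕ} (hp0 : p 0 = 0) {m : ℝ}
    (hm : HasSum (fun k : ℕ => (k : ℝ) * (p k).toReal) m) {lam : ℝ≥0} (hlam : lam < 1) :
    (distortion lam)⁻¹ * m ≤ ∫ τ, nuPlus τ ∂agw p lam ∧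
      ∫ τ, nuPlus τ ∂agw p lam ≤ distortion lam * m := by
  have hm0 : 0 ≤ m := hm.nonneg fun k => by positivity
  have hd := distortion_pos hlam
  rw [integral_eq_lintegral_of_nonneg_ae (ae_of_all _ nuPlus_nonneg)
    measurable_nuPlus.aestronglyMeasurable]
  have h2 := lintegral_nuPlus_le hp0 hm hlam
  constructor
  · exact (ENNReal.ofReal_le_iff_le_toReal (h2.trans_lt ENNReal.ofReal_lt_top).ne).1
      (le_lintegral_nuPlus hp0 hm hlam)
  · exact ENNReal.toReal_le_of_le_ofReal (by positivity) h2

theorem tendsto_distortion : Tendsto distortion (𝓝[>] 0) (𝓝 1) := by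
  have h : ContinuousAt distortion 0 := by
    unfold distortion
    refine ContinuousAt.div (by fun_prop) (by fun_prop) (by simp)
  have h0 : distortion 0 = 1 := by simp [distortion]
  have h1 := h.tendsto
  rw [h0] at h1
  exact h1.mono_left nhdsWithin_le_nhds

end BiasedWalk

theorem proposition5p4 (p : PMF ℕ) (hp0 : p 0 = 0) (hp1 : ∀ k, p k < 1) (m : ℝ)
    (hm : HasSum (fun k : ℕ => (k : ℝ) * (p k).toReal) m) :
    (∀ lam : ℝ≥0, 0 < lam → lam < 1 →
      IsProbabilityMeasure (BiasedWalk.agw p lam) ∧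
        Integrable BiasedWalk.nuPlus (BiasedWalk.agw p lam)) ∧
    Tendsto (fun lam : ℝ≥0 => ∫ τ, BiasedWalk.nuPlus τ ∂(BiasedWalk.agw p lam))
      (𝓝[>] 0) (𝓝 m) := by
  refine ⟨fun lam _ hlam => ⟨BiasedWalk.isProbabilityMeasure_agw p hlam,
    BiasedWalk.integrable_nuPlus_agw hp0 hm hlam⟩, ?_⟩
  have hev : ∀ᶠ lam : ℝ≥0 in 𝓝[>] 0, lam < 1 :=
    nhdsWithin_le_nhds (Iio_mem_nhds one_pos)
  have hlo : Tendsto (fun lam : ℝ≥0 => (BiasedWalk.distortion lam)⁻¹ * m) (𝓝[>] 0) (𝓝 m) := by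
    simpa using (BiasedWalk.tendsto_distortion.inv₀ one_ne_zero).mul_const m
  have hhi : Tendsto (fun lam : ℝ≥0 => BiasedWalk.distortion lam * m) (𝓝[>] 0) (𝓝 m) := by
    simpa using BiasedWalk.tendsto_distortion.mul_const m
  -- Squeeze between `D⁻¹ m` and `D m`; the bounds hold only for `lam < 1`, hence eventually.
  refine tendsto_of_tendsto_of_tendsto_of_le_of_le' hlo hhi ?_ ?_
  · filter_upwards [hev] with lam hlam
    exact (BiasedWalk.integral_nuPlus_bounds hp0 hm hlam).1
  · filter_upwards [hev] with lam hlam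
    exact (BiasedWalk.integral_nuPlus_bounds hp0 hm hlam).2
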